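/- A source (node $0$) communicates with nodes $\mathcal N=\{1,\dots,n\}$. There are independent Poisson processes: source self-updates of rate $\lambda_e\ge 0$; for each $j\in\mathcal N$, updates from the source to $j$ of rate $\lambda_{0j}\ge 0$; for each ordered pair $i\ne j$ in $\mathcal N$, gossip from $i$ to $j$ of rate $\lambda_{ij}\ge 0$ (zero if there is no connection from $i$ to $j$); and for each unordered pair $\{i,j\}\subseteq\{0\}\cup\mathcal N$, $i\neq j$, contacts of $i$ and $j$ (contact mobility) of rate $\lambda^m_{\{i,j\}}\ge 0$. The version age $X_i(t)$ of node $i$ (the number of versions by which it is behind the source) is a nonnegative integer that changes only at these events, with $X_0\equiv 0$: at a source self-update every $X_l$, $l\in\mathcal N$, increases by $1$; at an update from the source to $j$, $X_j$ becomes $0$; at a gossip from $i$ to $j$, $X_j$ becomes $\min\{X_i,X_j\}$; at a contact of $i$ and $j$, both ages become $\min\{X_i,X_j\}$. The initial ages are independent of the Poisson processes and have finite means. For nonempty $S\subseteq\mathcal N$ put $\lambda_0(S)=\sum_{i\in S}\lambda_{0i}$, $\lambda^m_0(S)=\sum_{i\in S}\lambda^m_{\{0,i\}}$ and, for $i\in\mathcal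 N\setminus S$, $\lambda_i(S)=\sum_{j\in S}\lambda_{ij}$, $\lambda^m_i(S)=\sum_{j\in S}\lambda^m_{\{i,j\}}$. Let $N(S)$ (resp. $M(S)$) be the set of $i\in\mathcal N\setminus S$ with $\lambda_{ij}>0$ (resp. $\lambda^m_{\{i,j\}}>0$) for some $j\in S$, and let $$D(S)=\lambda_0(S)+\sum_{i\in N(S)}\lambda_i(S)+\lambda^m_0(S)+\sum_{i\in M(S)}\lambda^m_i(S)$$ be the total rate at which information enters $S$. Let $S\subseteq\mathcal N$ be nonempty and suppose that $D(T)>0$ for all $T$ with $S\subseteq T\subseteq\mathcal N$. (If all the rates $\lambda^m_{\{i,j\}}$ with $i\neq j$ in $\mathcal N$ are positive, this only says that $\lambda_{0i}+\lambda^m_{\{0,i\}}>0$ for some $i\in\mathcal N$.) Then $\mathbb E[\min_{i\in T}X_i(t)]$ is finite for all $t\ge0$ and the steady-state average version age $$\tilde v_T=\lim_{t\to\infty}\mathbb E\Bigl[\min_{i\in T}X_i(t)\Bigr]$$ exists and is finite for every $T$ with $S\subseteq T\subseteq\mathcal N$, and $$\tilde v_S=\frac{\lambda_e+\sum_{i\in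 N(S)}\lambda_i(S)\,\tilde v_{S\cup\{i\}}+\sum_{i\in M(S)}\lambda^m_i(S)\,\tilde v_{S\cup\{i\}}}{\lambda_0(S)+\sum_{i\in N(S)}\lambda_i(S)+\lambda^m_0(S)+\sum_{i\in M(S)}\lambda^m_i(S)} .$$ -/

import Mathlib

open MeasureTheory ProbabilityTheory Filter Topology
open scoped NNReal

namespace Gossip

/-- `N` is a (homogeneous) Poisson process of rate `r` on the probability space `(Ω, μ)`: it counts
from `0`, has nondecreasing right-continuous paths, independent increments, and its increment over
`(s, t]` is Poisson distributed with mean `r * (t - s)`.  (Rate `0` gives the zero process.) -/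
structure IsPoissonProcess {Ω : Type*} [MeasurableSpace Ω] (μ : Measure Ω)
    (N : ℝ≥0 → Ω → ℕ) (r : ℝ≥0) : Prop where
  measurable : ∀ t, Measurable (N t)
  zero : ∀ᵐ ω ∂μ, N 0 ω = 0
  mono : ∀ᵐ ω ∂μ, Monotone fun t => N t ω
  rightCont : ∀ᵐ ω ∂μ, ∀ t, ContinuousWithinAt (fun u => N u ω) (Set.Ici t) t
  indepIncrements : HasIndepIncrements N μ
  law : ∀ s t, s ≤ t → HasLaw (fun ω => N t ω - N s ω) (poissonMeasure (r * (t - s))) μ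

/-- The rates of a mobile gossip network with nodes `Fin n` and one source.  The nodes together
with the source are `Option (Fin n)`, where `none` is the source. -/
structure Network (n : ℕ) where
  /-- rate `λ_e` of the self-updates of the source -/
  srcRate : ℝ≥0
  /-- rate `λ_{0j}` of the updates pushed by the source to node `j` -/
  pushRate : Fin n → ℝ≥0
  /-- rate `λ_{ij}` at which node `i` gossips to node `j`; it is `0` if there is no connection
  from `i` to `j`, and the diagonal is never used -/
  gossipRate : Fin n → Fin n → ℝ≥0
  /-- rate `λ^m_{i,j}` at which the unordered pair `{i, j}` (of nodes, or of a node and the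
  source) comes in contact; the diagonal is never used -/
  mobRate : Sym2 (Option (Fin n)) → ℝ≥0

/-- The events (transitions) of the network. -/
inductive Event (n : ℕ) : Type
  /-- the source updates itself -/
  | selfUpdate : Event n
  /-- the source sends an update to node `j` -/
  | push (j : Fin n) : Event n
  /-- node `i` gossips to node `j` -/
  | gossip (i j : Fin n) (h : i ≠ j) : Event n
  /-- the two distinct members of the unordered pair `p` meet -/
  | contact (p : Sym2 (Option (Fin n))) (h : ¬ p.IsDiag) : Event n

/-- The age of the source (always `0`) and of the nodes in the state `x`. -/
def extAge {n : ℕ} (x : Fin n → ℕ) : Option (Fin n) → ℕ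
  | none => 0
  | some i => x i

/-- The version ages after the event `e`, when the version ages before it are `x`. -/
def jump {n : ℕ} (e : Event n) (x : Fin n → ℕ) (l : Fin n) : ℕ :=
  match e with
  | .selfUpdate => x l + 1
  | .push j => if l = j then 0 else x l
  | .gossip i j _ => if l = j then min (x l) (x i) else x l
  | .contact p _ => if some l ∈ p then (p.map (extAge x)).inf else x l

/-- `X t ω` is the vector of version ages at time `t`, driven by the event clocks `clock e`. -/
structure IsAgeProcess {n : ℕ} {Ω : Type*} [MeasurableSpace Ω] (μ : Measure Ω)
    (clock : Event n → ℝ≥0 → Ω → ℕ) (X : ℝ≥0 → Ω → Fin n → ℕ) : Prop where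
  measurable : ∀ t, Measurable (X t)
  /-- the ages do not change over a time interval in which no clock ticks -/
  idle : ∀ᵐ ω ∂μ, ∀ s t, s ≤ t → (∀ e, clock e t ω = clock e s ω) → X t ω = X s ω
  /-- over a time interval in which the clock of `e` ticks once and no other clock ticks, the ages
  are transformed by the event `e` -/
  tick : ∀ᵐ ω ∂μ, ∀ s t, s ≤ t → ∀ e, clock e t ω = clock e s ω + 1 →
    (∀ e', e' ≠ e → clock e' t ω = clock e' s ω) → X t ω = jump e (X s ω)

namespace Network

variable {n : ℕ} (net : Network n)

/-- The rate of an event. -/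
def rate : Event n → ℝ≥0
  | .selfUpdate => net.srcRate
  | .push j => net.pushRate j
  | .gossip i j _ => net.gossipRate i j
  | .contact p _ => net.mobRate p

/-- `λ_0(S)`: total rate of source pushes into `S`. -/
def pushInto (S : Finset (Fin n)) : ℝ≥0 := ∑ i ∈ S, net.pushRate i

/-- `λ^m_0(S)`: total rate of contacts of the source with `S`. -/
def srcMobInto (S : Finset (Fin n)) : ℝ≥0 := ∑ i ∈ S, net.mobRate s(none, some i)

/-- `λ_i(S)`: total rate of gossip from node `i` into `S`. -/
def gossipInto (i : Fin n) (S : Finset (Fin n)) : ℝ≥0 := ∑ j ∈ S, net.gossipRate i j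

/-- `λ^m_i(S)`: total rate of contacts of node `i` with `S`. -/
def mobInto (i : Fin n) (S : Finset (Fin n)) : ℝ≥0 :=
  ∑ j ∈ S, net.mobRate s(some i, some j)

open Classical in
/-- `N(S)`: the nodes outside `S` that can send gossip into `S`. -/
noncomputable def gossipNbrs (S : Finset (Fin n)) : Finset (Fin n) :=
  {i | i ∉ S ∧ ∃ j ∈ S, 0 < net.gossipRate i j}

open Classical in
/-- `M(S)`: the nodes outside `S` that can meet nodes in `S`. -/
noncomputable def mobNbrs (S : Finset (Fin n)) : Finset (Fin n) :=
  {i | i ∉ S ∧ ∃ j ∈ S, 0 < net.mobRate s(some i, some j)}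

/-- The total rate at which information enters `S`. -/
noncomputable def totalInto (S : Finset (Fin n)) : ℝ≥0 :=
  net.pushInto S + ∑ i ∈ net.gossipNbrs S, net.gossipInto i S
    + net.srcMobInto S + ∑ i ∈ net.mobNbrs S, net.mobInto i S

end Network

/-- `v` is the steady-state average version age of the nonempty set `S` of nodes: the expectation
of `min_{i ∈ S} X_i(t)` is finite at all times and tends to `v` as `t → ∞`. -/
def HasSteadyAge {n : ℕ} {Ω : Type*} [MeasurableSpace Ω] (μ : Measure Ω)
    (X : ℝ≥0 → Ω → Fin n → ℕ) (S : Finset (Fin n)) (hS : S.Nonempty) (v : ℝ) : Prop :=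
  (∀ t, Integrable (fun ω => ((S.inf' hS (X t ω) : ℕ) : ℝ)) μ) ∧
    Tendsto (fun t => ∫ ω, ((S.inf' hS (X t ω) : ℕ) : ℝ) ∂μ) atTop (𝓝 v)

end Gossip

/-! Write f_T for the minimal age in T and m_T(t) for its mean. A self-update raises f_T by 1; a
push or a contact from the source into T resets it to 0; gossip or a contact from a node i outside T
into T replaces it by f_{T ∪ {i}}; every other event leaves it unchanged. Weighting the changes by
the rates gives the drift of f_T (`drift_eq`), and in expectation m_T' = g_T - D(T) m_T, where g_T
is λ_e plus a nonnegative combination of the means m_{T ∪ {i}} with i outside T. If D(T) > 0 and g_T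
converges, then m_T relaxes to lim g_T / D(T) (`tendsto_of_relaxation`). Induction on the complement
of T gives all limits, and the limit equation is the recursion.

The differential equation needs care because `X` is described only over intervals with at most one
tick. A fine partition almost surely has no cell with two ticks, so the ages are recovered from the
initial ages and the increments of the clocks; hence the ages at time s are independent of the ticks
after s (`indepFun_age_ticks`). Over (s, t] the change of f_T is the sum of the single-event changes
up to an error caused by two or more ticks, whose mean is of order (t - s)² (`abs_meanAge_sub_le`).
This yields continuity of m_T and its right derivative, which is all that the relaxation argument
uses. -/

namespace Gossip

/-! ### Effect of a single event on the minimal age -/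

variable {n : ℕ}

/-- The events as a disjoint union of finite types. -/
def Event.equivSum : Event n ≃ Unit ⊕ Fin n ⊕ {q : Fin n × Fin n // q.1 ≠ q.2} ⊕
    {p : Sym2 (Option (Fin n)) // ¬ p.IsDiag} where
  toFun
    | .selfUpdate => .inl ()
    | .push j => .inr (.inl j)
    | .gossip i j h => .inr (.inr (.inl ⟨(i, j), h⟩))
    | .contact p h => .inr (.inr (.inr ⟨p, h⟩))
  invFun
    | .inl _ => .selfUpdate
    | .inr (.inl j) => .push j
    | .inr (.inr (.inl q)) => .gossip q.1.1 q.1.2 q.2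
    | .inr (.inr (.inr p)) => .contact p.1 p.2
  left_inv e := by cases e <;> rfl
  right_inv e := by rcases e with _ | _ | _ | _ <;> rfl

noncomputable instance : Fintype (Event n) := by
  classical exact Fintype.ofEquiv _ Event.equivSum.symm

noncomputable instance : DecidableEq (Event n) := Classical.decEq _

lemma Event.sum_eq (F : Event n → ℝ) :
    ∑ e, F e = F .selfUpdate + ∑ j, F (.push j)
      + ∑ q : {q : Fin n × Fin n // q.1 ≠ q.2}, F (.gossip q.1.1 q.1.2 q.2)
      + ∑ p : {p : Sym2 (Option (Fin n)) // ¬ p.IsDiag}, F (.contact p.1 p.2) := by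
  rw [← Event.equivSum.symm.sum_comp F]
  simp only [Fintype.sum_sum_type, Finset.univ_unique, Finset.sum_singleton]
  rw [← add_assoc, ← add_assoc]
  rfl

lemma inf'_jump_selfUpdate (T : Finset (Fin n)) (hT : T.Nonempty) (x : Fin n → ℕ) :
    T.inf' hT (jump .selfUpdate x) = T.inf' hT x + 1 := by
  obtain ⟨l, hl, hl'⟩ := T.exists_mem_eq_inf' hT x
  apply le_antisymm
  · rw [hl']
    exact T.inf'_le _ hl
  · refine T.le_inf' hT _ fun l hl => ?_
    exact Nat.succ_le_succ (T.inf'_le _ hl)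

lemma inf'_jump_push (T : Finset (Fin n)) (hT : T.Nonempty) (x : Fin n → ℕ) (j : Fin n) :
    T.inf' hT (jump (.push j) x) = if j ∈ T then 0 else T.inf' hT x := by
  split_ifs with hj
  · exact Nat.le_zero.1 ((T.inf'_le _ hj).trans (by simp [jump]))
  · refine Finset.inf'_congr hT rfl fun l hl => ?_
    have : l ≠ j := fun h => hj (h ▸ hl)
    simp [jump, this]

lemma inf'_jump_gossip (T : Finset (Fin n)) (hT : T.Nonempty) (x : Fin n → ℕ) (i j : Fin n)
    (h : i ≠ j) :
    T.inf' hT (jump (.gossip i j h) x) =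
      if j ∈ T then min (x i) (T.inf' hT x) else T.inf' hT x := by
  split_ifs with hj
  · apply le_antisymm
    · refine le_min ((T.inf'_le _ hj).trans (by simp [jump])) (T.le_inf' hT _ fun l hl => ?_)
      refine (T.inf'_le _ hl).trans ?_
      simp only [jump]
      split_ifs <;> simp
    · refine T.le_inf' hT _ fun l hl => ?_
      have := T.inf'_le x hl
      simp only [jump]
      split_ifs <;> omega
  · refine Finset.inf'_congr hT rfl fun l hl => ?_
    have : l ≠ j := fun h => hj (h ▸ hl)
    simp [jump, this]

/-- Both members of the pair receive the smaller of their two ages, which exceeds neither old age,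
so one member in T is enough for the minimum over T to see it. -/
lemma inf'_jump_contact (T : Finset (Fin n)) (hT : T.Nonempty) (x : Fin n → ℕ)
    (p : Sym2 (Option (Fin n))) (h : ¬ p.IsDiag) [Decidable (∃ l ∈ T, some l ∈ p)] :
    T.inf' hT (jump (.contact p h) x) =
      if ∃ l ∈ T, some l ∈ p then min (p.map (extAge x)).inf (T.inf' hT x)
      else T.inf' hT x := by
  have hle : ∀ l, some l ∈ p → (p.map (extAge x)).inf ≤ x l := by
    intro l hl
    induction p with | _ a b =>
    rcases Sym2.mem_iff.1 hl with rfl | rfl <;> simp [extAge]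
  split_ifs with hj
  · obtain ⟨j, hj, hjp⟩ := hj
    apply le_antisymm
    · refine le_min ((T.inf'_le _ hj).trans (by simp [jump, hjp])) (T.le_inf' hT _ fun l hl => ?_)
      refine (T.inf'_le _ hl).trans ?_
      simp only [jump]
      split_ifs with hlp
      · exact hle l hlp
      · exact le_rfl
    · refine T.le_inf' hT _ fun l hl => ?_
      have := T.inf'_le x hl
      simp only [jump]
      split_ifs <;> omega
  · refine Finset.inf'_congr hT rfl fun l hl => ?_
    have : some l ∉ p := fun h => hj ⟨l, hl, h⟩
    simp [jump, this]

lemma inf'_jump_le (T : Finset (Fin n)) (hT : T.Nonempty) (e : Event n) (x : Fin n → ℕ) :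
    T.inf' hT (jump e x) ≤ T.inf' hT x + 1 := by
  classical
  cases e with
  | selfUpdate => rw [inf'_jump_selfUpdate]
  | push j => rw [inf'_jump_push]; split_ifs <;> omega
  | gossip i j h => rw [inf'_jump_gossip]; split_ifs <;> omega
  | contact p h => rw [inf'_jump_contact]; split_ifs <;> omega

/-! ### The drift of the minimal age -/

namespace Network

variable (net : Network n) (T : Finset (Fin n)) (hT : T.Nonempty) (x : Fin n → ℕ)

/-- A node outside T that is not a neighbour has total rate 0 into T, so the sum may run over the
whole complement, which is the shape that the sum over events produces. -/
lemma sum_gossipNbrs (F : Fin n → ℝ) :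
    ∑ i ∈ net.gossipNbrs T, (net.gossipInto i T : ℝ) * F i =
      ∑ i ∈ Finset.univ.filter (· ∉ T), ∑ j ∈ T, (net.gossipRate i j : ℝ) * F i := by
  have : ∀ i, (net.gossipInto i T : ℝ) * F i = ∑ j ∈ T, (net.gossipRate i j : ℝ) * F i := by
    intro i
    rw [gossipInto, NNReal.coe_sum, Finset.sum_mul]
  simp_rw [← this]
  refine Finset.sum_subset (fun i hi => by simp_all [gossipNbrs]) fun i hi hi' => ?_
  have : net.gossipInto i T = 0 := by
    refine Finset.sum_eq_zero fun j hj => ?_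
    by_contra h0
    exact hi' (by simp_all [gossipNbrs])
  simp [this]

lemma sum_mobNbrs (F : Fin n → ℝ) :
    ∑ i ∈ net.mobNbrs T, (net.mobInto i T : ℝ) * F i =
      ∑ i ∈ Finset.univ.filter (· ∉ T), ∑ j ∈ T, (net.mobRate s(some i, some j) : ℝ) * F i := by
  have : ∀ i, (net.mobInto i T : ℝ) * F i =
      ∑ j ∈ T, (net.mobRate s(some i, some j) : ℝ) * F i := by
    intro i
    rw [mobInto, NNReal.coe_sum, Finset.sum_mul]
  simp_rw [← this]
  refine Finset.sum_subset (fun i hi => by simp_all [mobNbrs]) fun i hi hi' => ?_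
  have : net.mobInto i T = 0 := by
    refine Finset.sum_eq_zero fun j hj => ?_
    by_contra h0
    exact hi' (by simp_all [mobNbrs])
  simp [this]

/-- The expected infinitesimal change of the minimal age of `T` in the state `x`. -/
noncomputable def drift : ℝ :=
  ∑ e, (net.rate e : ℝ) * ((T.inf' hT (jump e x) : ℕ) - (T.inf' hT x : ℕ))

lemma sum_push :
    ∑ j, (net.rate (.push j) : ℝ) *
        (((T.inf' hT (jump (.push j) x) : ℕ) : ℝ) - (T.inf' hT x : ℕ)) =
      - (net.pushInto T * (T.inf' hT x : ℕ)) := by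
  rw [pushInto, NNReal.coe_sum, Finset.sum_mul, ← Finset.sum_neg_distrib,
    ← Finset.sum_subset (Finset.subset_univ T)]
  · refine Finset.sum_congr rfl fun j hj => ?_
    simp [inf'_jump_push, hj, rate]
  · intro j _ hj
    simp [inf'_jump_push, hj]

lemma sum_gossip :
    ∑ q : {q : Fin n × Fin n // q.1 ≠ q.2}, (net.rate (.gossip q.1.1 q.1.2 q.2) : ℝ) *
        (((T.inf' hT (jump (.gossip q.1.1 q.1.2 q.2) x) : ℕ) : ℝ) - (T.inf' hT x : ℕ)) =
      ∑ i ∈ net.gossipNbrs T, (net.gossipInto i T : ℝ) *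
        ((((insert i T).inf' (T.insert_nonempty i) x : ℕ) : ℝ) - (T.inf' hT x : ℕ)) := by
  simp only [inf'_jump_gossip, rate]
  rw [sum_gossipNbrs, ← Finset.sum_product', ← Finset.sum_subtype
    (Finset.univ.filter fun q : Fin n × Fin n => q.1 ≠ q.2) (by simp)
    (fun q => (net.gossipRate q.1 q.2 : ℝ) *
      (((if q.2 ∈ T then min (x q.1) (T.inf' hT x) else T.inf' hT x : ℕ) : ℝ)
        - (T.inf' hT x : ℕ)))]
  symm
  refine (Finset.sum_congr rfl fun q hq => ?_).trans (Finset.sum_subset (fun q hq => ?_) ?_)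
  · simp only [Finset.mem_product] at hq
    rw [if_pos hq.2, Finset.inf'_insert]
  · simp only [Finset.mem_product, Finset.mem_filter, Finset.mem_univ, true_and] at hq ⊢
    exact fun h => hq.1 (h ▸ hq.2)
  · intro q _ hq
    simp only [Finset.mem_product, Finset.mem_filter, Finset.mem_univ, true_and, not_and] at hq
    by_cases h2 : q.2 ∈ T
    · have h1 : q.1 ∈ T := not_not.1 fun h1 => hq h1 h2
      rw [if_pos h2, min_eq_right (T.inf'_le x h1), sub_self, mul_zero]
    · rw [if_neg h2, sub_self, mul_zero]

/-- Only pairs with exactly one member in T matter. They are parametrized by (a, j) with j in T and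
a outside T, where a may be the source; the source has age 0 and gives the subtracted term. -/
lemma sum_contact :
    ∑ p : {p : Sym2 (Option (Fin n)) // ¬ p.IsDiag}, (net.rate (.contact p.1 p.2) : ℝ) *
        (((T.inf' hT (jump (.contact p.1 p.2) x) : ℕ) : ℝ) - (T.inf' hT x : ℕ)) =
      ∑ i ∈ net.mobNbrs T, (net.mobInto i T : ℝ) *
        ((((insert i T).inf' (T.insert_nonempty i) x : ℕ) : ℝ) - (T.inf' hT x : ℕ))
      - net.srcMobInto T * (T.inf' hT x : ℕ) := by
  classical
  have hsplit : ∑ a ∈ Finset.univ.filter (fun a : Option (Fin n) => ∀ l ∈ T, a ≠ some l),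
      ∑ j ∈ T, (net.mobRate s(a, some j) : ℝ) *
        ((min (extAge x a) (T.inf' hT x) : ℕ) - (T.inf' hT x : ℕ)) =
      ∑ i ∈ net.mobNbrs T, (net.mobInto i T : ℝ) *
        ((((insert i T).inf' (T.insert_nonempty i) x : ℕ) : ℝ) - (T.inf' hT x : ℕ))
      - net.srcMobInto T * (T.inf' hT x : ℕ) := by
    have hmem : ∀ i, (∀ l ∈ T, i ≠ l) ↔ i ∉ T :=
      fun i => ⟨fun h hi => h i hi rfl, fun h l hl hil => h (hil ▸ hl)⟩
    have hcomb : ∀ a b c d : ℝ, a = -d → b = c → a + b = c - d := by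
      rintro a b c d rfl rfl
      ring
    rw [sum_mobNbrs, Finset.sum_filter, Fintype.sum_option, Finset.sum_filter, srcMobInto,
      NNReal.coe_sum, Finset.sum_mul]
    refine hcomb _ _ _ _ ?_ ?_
    · simp [extAge]
    · simp only [ne_eq, extAge, Option.some.injEq]
      refine Finset.sum_congr rfl fun i _ => if_congr (hmem i) ?_ rfl
      rw [Finset.inf'_insert]
  simp only [inf'_jump_contact, rate]
  rw [← hsplit, ← Finset.sum_product', ← Finset.sum_subtype
    (Finset.univ.filter fun p : Sym2 (Option (Fin n)) => ¬ p.IsDiag) (by simp)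
    (fun p => (net.mobRate p : ℝ) *
      (((if ∃ l ∈ T, some l ∈ p then min (p.map (extAge x)).inf (T.inf' hT x)
        else T.inf' hT x : ℕ) : ℝ) - (T.inf' hT x : ℕ)))]
  symm
  refine Finset.sum_of_injOn (fun q => s(q.1, some q.2)) ?_ ?_ ?_ ?_
  · rintro ⟨a, j⟩ hq ⟨a', j'⟩ hq' h
    simp only [Finset.coe_product, Set.mem_prod, Finset.mem_coe, Finset.mem_filter,
      Finset.mem_univ, true_and] at hq hq'
    -- The swapped equality would put the outer member a into T.
    rcases Sym2.eq_iff.1 h with ⟨h1, h2⟩ | ⟨h1, -⟩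
    · simp_all
    · exact absurd h1 (hq.1 _ hq'.2)
  · rintro ⟨a, j⟩ hq
    simp only [Finset.coe_product, Set.mem_prod, Finset.mem_coe, Finset.mem_filter,
      Finset.mem_univ, true_and] at hq
    simpa using hq.1 _ hq.2
  -- The remaining pairs lie inside T, where the pair's minimum is already at least the minimum over
  -- T, or avoid T.
  · intro p hp hp'
    split_ifs with h
    · obtain ⟨l, hl, hlp⟩ := h
      obtain ⟨a, rfl⟩ := hlp
      have ha : ¬ ∀ l ∈ T, a ≠ some l := by
        intro ha
        refine hp' ⟨(a, l), ?_, Sym2.eq_swap⟩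
        simpa using ⟨ha, hl⟩
      push Not at ha
      obtain ⟨k, hk, rfl⟩ := ha
      rw [min_eq_right, sub_self, mul_zero]
      simpa [extAge] using ⟨⟨l, hl, le_rfl⟩, ⟨k, hk, le_rfl⟩⟩
    · rw [sub_self, mul_zero]
  · rintro ⟨a, j⟩ hq
    simp only [Finset.mem_product, Finset.mem_filter, Finset.mem_univ, true_and] at hq
    have hj : ∃ l ∈ T, some l ∈ s(a, some j) := ⟨j, hq.2, by simp⟩
    have := T.inf'_le x hq.2
    rw [if_pos hj]
    simp only [Sym2.map_mk, Sym2.inf_mk, extAge, min_assoc, min_eq_right this]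

lemma drift_eq :
    net.drift T hT x = net.srcRate
      + ∑ i ∈ net.gossipNbrs T, (net.gossipInto i T : ℝ) *
        ((((insert i T).inf' (T.insert_nonempty i) x : ℕ) : ℝ) - (T.inf' hT x : ℕ))
      + ∑ i ∈ net.mobNbrs T, (net.mobInto i T : ℝ) *
        ((((insert i T).inf' (T.insert_nonempty i) x : ℕ) : ℝ) - (T.inf' hT x : ℕ))
      - (net.pushInto T + net.srcMobInto T) * (T.inf' hT x : ℕ) := by
  rw [drift, Event.sum_eq, sum_push, sum_gossip, sum_contact, inf'_jump_selfUpdate]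
  simp only [rate]
  push_cast
  ring

end Network
-- Factorial moments of Poisson laws
open scoped Nat in
-- The terms with m < k vanish, and after the shift m ↦ m + k the falling factorial reduces (m + k)!
-- to m!, leaving r ^ k times the Poisson weights. The case k = 1 gives mean tick counts, k = 2
-- controls multiple ticks.
lemma hasSum_descFactorial_poisson (r : ℝ≥0) (k : ℕ) :
    HasSum (fun m : ℕ => Real.exp (-r) * r ^ m / m ! * (m.descFactorial k : ℝ)) (r ^ k) := by
  have h := (hasSum_one_poissonMeasure r).mul_left ((r : ℝ) ^ k)
  rw [mul_one] at h
  have h0 : ∑ i ∈ Finset.range k,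
      Real.exp (-r) * (r : ℝ) ^ i / i ! * (i.descFactorial k : ℝ) = 0 := by
    refine Finset.sum_eq_zero fun i hi => ?_
    rw [Nat.descFactorial_of_lt (Finset.mem_range.1 hi), Nat.cast_zero, mul_zero]
  refine (hasSum_nat_add_iff' k).1 ?_
  rw [h0, sub_zero]
  suffices hfun : (fun m : ℕ => Real.exp (-r) * (r : ℝ) ^ (m + k) / (m + k)! *
      ((m + k).descFactorial k : ℝ)) =
      fun m : ℕ => (r : ℝ) ^ k * (Real.exp (-r) * (r : ℝ) ^ m / m !) by
    rw [hfun]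
    exact h
  ext m
  have : ((m + k).descFactorial k : ℝ) * m ! = (m + k)! := by
    have := Nat.factorial_mul_descFactorial (Nat.le_add_left k m)
    rw [Nat.add_sub_cancel] at this
    rw [← this]
    push_cast
    ring
  have h1 : ((m + k).descFactorial k : ℝ) ≠ 0 := by
    have : (m + k).descFactorial k ≠ 0 := by
      rw [Ne, Nat.descFactorial_eq_zero_iff_lt]; omega
    exact_mod_cast this
  rw [← this, pow_add]
  field_simp

lemma integrable_descFactorial_poissonMeasure (r : ℝ≥0) (k : ℕ) :
    Integrable (fun m : ℕ => (m.descFactorial k : ℝ)) (poissonMeasure r) := by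
  rw [integrable_poissonMeasure_iff]
  simpa using (hasSum_descFactorial_poisson r k).summable

lemma integral_descFactorial_poissonMeasure (r : ℝ≥0) (k : ℕ) :
    ∫ m : ℕ, (m.descFactorial k : ℝ) ∂(poissonMeasure r) = r ^ k := by
  rw [integral_poissonMeasure]
  simpa using (hasSum_descFactorial_poisson r k).tsum_eq

section

variable {Ω : Type*} [MeasurableSpace Ω] {μ : Measure Ω}

lemma integrable_descFactorial_of_hasLaw {G : Ω → ℕ} {r : ℝ≥0}
    (hG : HasLaw G (poissonMeasure r) μ) (k : ℕ) :
    Integrable (fun ω => ((G ω).descFactorial k : ℝ)) μ := by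
  have := integrable_descFactorial_poissonMeasure r k
  rw [← hG.map_eq] at this
  exact this.comp_aemeasurable hG.aemeasurable

lemma integral_descFactorial_of_hasLaw {G : Ω → ℕ} {r : ℝ≥0}
    (hG : HasLaw G (poissonMeasure r) μ) (k : ℕ) :
    ∫ ω, ((G ω).descFactorial k : ℝ) ∂μ = r ^ k := by
  rw [← integral_descFactorial_poissonMeasure r k]
  exact hG.integral_comp (f := fun m : ℕ => (m.descFactorial k : ℝ))
    Measurable.of_discrete.aestronglyMeasurable

lemma hasLaw_sum_poissonMeasure {ι : Type*} {G : ι → Ω → ℕ} {r : ι → ℝ≥0}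
    (hG : ∀ i, HasLaw (G i) (poissonMeasure (r i)) μ) (hind : iIndepFun G μ)
    {s : Finset ι} (hs : s.Nonempty) :
    HasLaw (∑ i ∈ s, G i) (poissonMeasure (∑ i ∈ s, r i)) μ := by
  induction hs using Finset.Nonempty.cons_induction with
  | singleton a => simpa using hG a
  | cons a s ha hs ih =>
    rw [Finset.sum_cons, Finset.sum_cons]
    exact (hind.indepFun_finsetSum_of_notMem₀ (fun i => (hG i).aemeasurable)
      ha).symm.hasLaw_add_poissonMeasure (hG a) ih

end

/-! ### Tick counts and partitions with at most one tick per cell -/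

/-- The number of ticks of each clock over a time interval. -/
def ticks {Ω : Type*} (clock : Event n → ℝ≥0 → Ω → ℕ) (s t : ℝ≥0) (ω : Ω) (e : Event n) : ℕ :=
  clock e t ω - clock e s ω

/-- The total number of ticks over a time interval. -/
noncomputable def totalTicks {Ω : Type*} (clock : Event n → ℝ≥0 → Ω → ℕ) (s t : ℝ≥0) (ω : Ω) : ℕ :=
  ∑ e, ticks clock s t ω e

/-- The total rate of all events. -/
noncomputable def Network.totalRate (net : Network n) : ℝ≥0 := ∑ e, net.rate e

section

variable {net : Network n} {Ω : Type*} [MeasurableSpace Ω] {μ : Measure Ω}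
  {clock : Event n → ℝ≥0 → Ω → ℕ}

lemma measurable_totalTicks (hclock : ∀ e, IsPoissonProcess μ (clock e) (net.rate e))
    (s t : ℝ≥0) : Measurable (totalTicks clock s t) :=
  Finset.measurable_fun_sum _ fun e _ => ((hclock e).measurable t).sub ((hclock e).measurable s)

lemma hasLaw_totalTicks (hclock : ∀ e, IsPoissonProcess μ (clock e) (net.rate e))
    (hindep : iIndepFun (fun e ω t => clock e t ω) μ) {s t : ℝ≥0} (hst : s ≤ t) :
    HasLaw (totalTicks clock s t) (poissonMeasure (net.totalRate * (t - s))) μ := by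
  have hind : iIndepFun (fun e ω => ticks clock s t ω e) μ :=
    hindep.comp (fun _ c => c t - c s)
      fun _ => (measurable_pi_apply t).sub (measurable_pi_apply s)
  have := hasLaw_sum_poissonMeasure (fun e => (hclock e).law s t hst) hind
    (s := Finset.univ) ⟨.selfUpdate, Finset.mem_univ _⟩
  rw [← Finset.sum_mul] at this
  convert this using 1
  · ext ω
    simp [totalTicks, ticks]
  · rfl

variable [IsProbabilityMeasure μ]

/-- Markov's inequality for K(K - 1), which is at least 1 when K ≥ 2. -/
lemma measureReal_two_le_totalTicks
    (hclock : ∀ e, IsPoissonProcess μ (clock e) (net.rate e))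
    (hindep : iIndepFun (fun e ω t => clock e t ω) μ) {s t : ℝ≥0} (hst : s ≤ t) :
    μ.real {ω | 2 ≤ totalTicks clock s t ω} ≤ (net.totalRate * (t - s : ℝ≥0) : ℝ) ^ 2 := by
  have hlaw := hasLaw_totalTicks hclock hindep hst
  have hint := integral_descFactorial_of_hasLaw hlaw 2
  rw [NNReal.coe_mul] at hint
  rw [← hint]
  have hm : MeasurableSet {ω | 2 ≤ totalTicks clock s t ω} :=
    measurableSet_le measurable_const (measurable_totalTicks hclock s t)
  rw [← integral_indicator_one hm]
  refine integral_mono ((integrable_const (1 : ℝ)).indicator hm)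
    (integrable_descFactorial_of_hasLaw hlaw 2) fun ω => ?_
  refine Set.indicator_apply_le' (fun h => ?_) fun _ => Nat.cast_nonneg _
  have : 1 ≤ (totalTicks clock s t ω).descFactorial 2 :=
    Nat.one_le_iff_ne_zero.2 (by rw [Ne, Nat.descFactorial_eq_zero_iff_lt]; exact not_lt.2 h)
  simpa only [Pi.one_apply, Nat.one_le_cast] using this

/-- The `k`-th point of the equidistant partition of the interval from `a` to `b` in `N` parts. -/
noncomputable def partPt (a b : ℝ≥0) (N k : ℕ) : ℝ≥0 := a + k * ((b - a) / N)

lemma partPt_mono (a b : ℝ≥0) (N : ℕ) : Monotone (partPt a b N) := by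
  intro k l h
  unfold partPt
  gcongr

@[simp] lemma partPt_zero (a b : ℝ≥0) (N : ℕ) : partPt a b N 0 = a := by simp [partPt]

lemma partPt_self {a b : ℝ≥0} (hab : a ≤ b) {N : ℕ} (hN : N ≠ 0) : partPt a b N N = b := by
  have : (N : ℝ≥0) ≠ 0 := by exact_mod_cast hN
  rw [partPt, mul_div_cancel₀ _ this, add_tsub_cancel_of_le hab]

/-- Every part of the partition in `N` parts has at most one tick. -/
def GoodPart {Ω : Type*} (clock : Event n → ℝ≥0 → Ω → ℕ) (a b : ℝ≥0) (N : ℕ) (ω : Ω) : Prop :=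
  ∀ k < N, totalTicks clock (partPt a b N k) (partPt a b N (k + 1)) ω ≤ 1

/-- A union bound over N cells, each bad with probability O(1/N²). -/
lemma measureReal_not_goodPart_le
    (hclock : ∀ e, IsPoissonProcess μ (clock e) (net.rate e))
    (hindep : iIndepFun (fun e ω t => clock e t ω) μ) (a b : ℝ≥0) (N : ℕ) :
    μ.real {ω | ¬ GoodPart clock a b N ω} ≤ (net.totalRate * (b - a : ℝ≥0) : ℝ) ^ 2 / N := by
  have hsub : {ω | ¬ GoodPart clock a b N ω} ⊆ ⋃ k ∈ Finset.range N,
      {ω | 2 ≤ totalTicks clock (partPt a b N k) (partPt a b N (k + 1)) ω} := by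
    intro ω hω
    simp only [GoodPart, Set.mem_ofPred_eq, not_forall, not_le] at hω
    obtain ⟨k, hk, h⟩ := hω
    simp only [Set.mem_iUnion, Finset.mem_range]
    exact ⟨k, hk, h⟩
  refine (measureReal_mono hsub (measure_ne_top _ _)).trans ((measureReal_biUnion_finset_le _ _).trans ?_)
  calc _ ≤ ∑ k ∈ Finset.range N, (net.totalRate * ((b - a : ℝ≥0) / N) : ℝ) ^ 2 := by
        refine Finset.sum_le_sum fun k _ => ?_
        refine (measureReal_two_le_totalTicks hclock hindep (partPt_mono a b N k.le_succ)).trans ?_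
        have : partPt a b N (k + 1) - partPt a b N k = (b - a) / N := by
          rw [partPt, partPt, add_tsub_add_eq_tsub_left]
          push_cast
          rw [add_mul, one_mul, add_tsub_cancel_left]
        rw [this, NNReal.coe_div, NNReal.coe_natCast]
    _ ≤ _ := by
        rw [Finset.sum_const, Finset.card_range, nsmul_eq_mul]
        rcases eq_or_ne N 0 with rfl | hN
        · simp
        · have : (N : ℝ) ≠ 0 := by exact_mod_cast hN
          apply le_of_eq
          field_simp

lemma tendsto_measureReal_not_goodPart
    (hclock : ∀ e, IsPoissonProcess μ (clock e) (net.rate e))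
    (hindep : iIndepFun (fun e ω t => clock e t ω) μ) (a b : ℝ≥0) :
    Tendsto (fun N : ℕ => μ.real {ω | ¬ GoodPart clock a b N ω}) atTop (𝓝 0) :=
  squeeze_zero (fun _ => measureReal_nonneg)
    (fun N => measureReal_not_goodPart_le hclock hindep a b N)
    (tendsto_const_div_atTop_nhds_zero_nat _)

lemma ae_exists_goodPart
    (hclock : ∀ e, IsPoissonProcess μ (clock e) (net.rate e))
    (hindep : iIndepFun (fun e ω t => clock e t ω) μ) (a b : ℝ≥0) :
    ∀ᵐ ω ∂μ, ∃ N ≠ 0, GoodPart clock a b N ω := by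
  rw [ae_iff, ← measureReal_eq_zero_iff]
  refine le_antisymm (ge_of_tendsto (tendsto_measureReal_not_goodPart hclock hindep a b) ?_)
    measureReal_nonneg
  filter_upwards [eventually_ne_atTop 0] with N hN
  exact measureReal_mono fun ω hω hg => hω ⟨N, hN, hg⟩

end
-- Ages as a function of the ticks
open Classical in
/-- The ages after the ticks `g`, if there is at most one tick. -/
noncomputable def step (g : Event n → ℕ) (x : Fin n → ℕ) : Fin n → ℕ :=
  -- The default is the right value for no tick. For two or more ticks it is arbitrary: the
  -- comparison with `X` is made only for at most one tick.
  if h : ∃ e, g = Pi.single e 1 then jump h.choose x else x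

lemma step_zero (x : Fin n → ℕ) : step 0 x = x := by
  rw [step, dif_neg]
  rintro ⟨e, he⟩
  simpa using congrFun he e

lemma step_single (e : Event n) (x : Fin n → ℕ) : step (Pi.single e 1) x = jump e x := by
  have h : ∃ e', (Pi.single e 1 : Event n → ℕ) = Pi.single e' 1 := ⟨e, rfl⟩
  have he : h.choose = e := by
    by_contra hne
    have := congrFun h.choose_spec e
    rw [Pi.single_eq_same, Pi.single_eq_of_ne (Ne.symm hne)] at this
    exact one_ne_zero this
  rw [step, dif_pos h, he]

lemma eq_zero_or_eq_single_of_sum_le_one {g : Event n → ℕ} (hg : ∑ e, g e ≤ 1) :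
    g = 0 ∨ ∃ e, g = Pi.single e 1 := by
  by_cases h : ∃ e, g e ≠ 0
  · obtain ⟨e, he⟩ := h
    refine .inr ⟨e, ?_⟩
    rw [← Finset.add_sum_erase _ _ (Finset.mem_univ e)] at hg
    have h0 : ∑ e' ∈ Finset.univ.erase e, g e' = 0 := by omega
    ext e'
    rcases eq_or_ne e' e with rfl | hne
    · rw [Pi.single_eq_same]; omega
    · rw [Pi.single_eq_of_ne hne]
      exact Finset.sum_eq_zero_iff.1 h0 e' (by simp [hne])
  · push Not at h
    exact .inl (funext h)

lemma inf'_step_le (T : Finset (Fin n)) (hT : T.Nonempty) {g : Event n → ℕ}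
    (hg : ∑ e, g e ≤ 1) (x : Fin n → ℕ) :
    T.inf' hT (step g x) ≤ T.inf' hT x + ∑ e, g e := by
  rcases eq_zero_or_eq_single_of_sum_le_one hg with rfl | ⟨e, rfl⟩
  · simp [step_zero]
  · rw [step_single, Finset.sum_pi_single']
    simpa using inf'_jump_le T hT e x

/-- The ages after the first `k` batches of ticks `g`. -/
noncomputable def evol (g : ℕ → Event n → ℕ) (x : Fin n → ℕ) : ℕ → Fin n → ℕ
  | 0 => x
  | k + 1 => step (g k) (evol g x k)

lemma evol_congr {g g' : ℕ → Event n → ℕ} (x : Fin n → ℕ) {N : ℕ} (h : ∀ k < N, g k = g' k) :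
    evol g x N = evol g' x N := by
  induction N with
  | zero => rfl
  | succ N ih => rw [evol, evol, ih fun k hk => h k (by omega), h N (by omega)]

section

variable {net : Network n} {Ω : Type*} [MeasurableSpace Ω] {μ : Measure Ω}
  {clock : Event n → ℝ≥0 → Ω → ℕ} {X : ℝ≥0 → Ω → Fin n → ℕ}

lemma ae_monotone_clock (hclock : ∀ e, IsPoissonProcess μ (clock e) (net.rate e)) :
    ∀ᵐ ω ∂μ, ∀ e, Monotone fun t => clock e t ω :=
  ae_all_iff.2 fun e => (hclock e).mono

lemma ae_eq_step (hclock : ∀ e, IsPoissonProcess μ (clock e) (net.rate e))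
    (hX : IsAgeProcess μ clock X) :
    ∀ᵐ ω ∂μ, ∀ s t, s ≤ t → totalTicks clock s t ω ≤ 1 →
      X t ω = step (ticks clock s t ω) (X s ω) := by
  filter_upwards [ae_monotone_clock hclock, hX.idle, hX.tick] with ω hmono hidle htick s t hst hle
  have hadd : ∀ e, clock e t ω = clock e s ω + ticks clock s t ω e := fun e =>
    (add_tsub_cancel_of_le (hmono e hst)).symm
  rcases eq_zero_or_eq_single_of_sum_le_one hle with h | ⟨e, h⟩
  · rw [h, step_zero]
    exact hidle s t hst fun e => by rw [hadd, h]; rfl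
  · rw [h, step_single]
    refine htick s t hst e (by rw [hadd, h, Pi.single_eq_same]) fun e' he' => ?_
    rw [hadd, h, Pi.single_eq_of_ne he', add_zero]

lemma ae_eq_evol (hclock : ∀ e, IsPoissonProcess μ (clock e) (net.rate e))
    (hX : IsAgeProcess μ clock X) :
    ∀ᵐ ω ∂μ, ∀ a b N, GoodPart clock a b N ω → ∀ k ≤ N, X (partPt a b N k) ω =
      evol (fun k => ticks clock (partPt a b N k) (partPt a b N (k + 1)) ω) (X a ω) k := by
  filter_upwards [ae_eq_step hclock hX] with ω h a b N hgood k hk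
  induction k with
  | zero => rw [partPt_zero, evol]
  | succ k ih =>
    rw [evol, ← ih (by omega)]
    exact h _ _ (partPt_mono a b N k.le_succ) (hgood k (by omega))

/-- A good partition cuts the interval into cells with at most one tick, where each tick adds at
most 1; the bounds add up along the cells. -/
lemma ae_inf'_le [IsProbabilityMeasure μ]
    (hclock : ∀ e, IsPoissonProcess μ (clock e) (net.rate e))
    (hindep : iIndepFun (fun e ω t => clock e t ω) μ)
    (hX : IsAgeProcess μ clock X) (T : Finset (Fin n)) (hT : T.Nonempty)
    {s t : ℝ≥0} (hst : s ≤ t) :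
    ∀ᵐ ω ∂μ, T.inf' hT (X t ω) ≤ T.inf' hT (X s ω) + totalTicks clock s t ω := by
  filter_upwards [ae_monotone_clock hclock, ae_eq_step hclock hX,
    ae_exists_goodPart hclock hindep s t] with ω hmono hstep ⟨N, hN, hgood⟩
  have key : ∀ k ≤ N, T.inf' hT (X (partPt s t N k) ω) ≤
      T.inf' hT (X s ω) + totalTicks clock s (partPt s t N k) ω := by
    intro k hk
    induction k with
    | zero => rw [partPt_zero]; omega
    | succ k ih =>
      have hle : partPt s t N k ≤ partPt s t N (k + 1) := partPt_mono s t N k.le_succ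
      have h0 : s ≤ partPt s t N k := by
        simpa using partPt_mono s t N k.zero_le
      have hadd : totalTicks clock s (partPt s t N (k + 1)) ω =
          totalTicks clock s (partPt s t N k) ω +
            totalTicks clock (partPt s t N k) (partPt s t N (k + 1)) ω := by
        rw [totalTicks, totalTicks, totalTicks, ← Finset.sum_add_distrib]
        refine Finset.sum_congr rfl fun e _ => ?_
        have h1 := hmono e h0
        have h2 := hmono e hle
        simp only [ticks] at h1 h2 ⊢
        omega
      have h1 := inf'_step_le T hT (hgood k (by omega)) (X (partPt s t N k) ω)
      rw [hstep _ _ hle (hgood k (by omega)), hadd]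
      have h2 := ih (by omega)
      change _ ≤ _ + totalTicks clock _ _ ω at h1
      omega
  simpa [partPt_self hst hN] using key N le_rfl

/-! ### Independence of present ages and later ticks -/

lemma indepFun_prodMk_left {α β γ : Type*} [MeasurableSpace α] [MeasurableSpace β]
    [MeasurableSpace γ] [IsProbabilityMeasure μ] {U : Ω → α} {P : Ω → β} {Q : Ω → γ}
    (hU : Measurable U) (hP : Measurable P) (hQ : Measurable Q)
    (h : IndepFun U (fun ω => (P ω, Q ω)) μ) (hPQ : IndepFun P Q μ) :
    IndepFun (fun ω => (U ω, P ω)) Q μ := by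
  have := Measure.isProbabilityMeasure_map (μ := μ) hU.aemeasurable
  have := Measure.isProbabilityMeasure_map (μ := μ) hP.aemeasurable
  have := Measure.isProbabilityMeasure_map (μ := μ) hQ.aemeasurable
  have hUP : IndepFun U P μ := h.comp measurable_id measurable_fst
  rw [indepFun_iff_map_prod_eq_prod_map_map (by fun_prop) (by fun_prop)] at h hPQ hUP ⊢
  rw [hUP, ← MeasurableEquiv.prodAssoc.map_measurableEquiv_injective.eq_iff,
    Measure.prodAssoc_prod, ← hPQ, ← h, Measure.map_map (by fun_prop) (by fun_prop)]
  rfl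

/-- Replacing Y by Z N changes the probabilities in the product formula by at most the probability
that Y ≠ Z N, so the formula passes to the limit. -/
lemma indepFun_of_tendsto_measureReal_ne {α β : Type*} [MeasurableSpace α] [MeasurableSpace β]
    [IsProbabilityMeasure μ] {Y : Ω → α} {Z : ℕ → Ω → α} {G : Ω → β}
    (hZ : ∀ᶠ N in atTop, IndepFun (Z N) G μ)
    (hlim : Tendsto (fun N => μ.real {ω | Y ω ≠ Z N ω}) atTop (𝓝 0)) :
    IndepFun Y G μ := by
  rw [indepFun_iff_measure_inter_preimage_eq_mul]
  intro A B hA hB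
  have key : ∀ C : Set Ω, Tendsto (fun N => μ.real (Z N ⁻¹' A ∩ C)) atTop
      (𝓝 (μ.real (Y ⁻¹' A ∩ C))) := by
    intro C
    rw [tendsto_iff_norm_sub_tendsto_zero]
    refine squeeze_zero (fun _ => norm_nonneg _) (fun N => ?_) hlim
    rw [Real.norm_eq_abs, abs_sub_le_iff]
    constructor
    · rw [sub_le_iff_le_add']
      refine (measureReal_mono ?_).trans (measureReal_union_le _ _)
      rintro ω ⟨h1, h2⟩
      by_cases h : Y ω = Z N ω
      · exact .inl ⟨by simpa [h] using h1, h2⟩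
      · exact .inr h
    · rw [sub_le_iff_le_add']
      refine (measureReal_mono ?_).trans (measureReal_union_le _ _)
      rintro ω ⟨h1, h2⟩
      by_cases h : Y ω = Z N ω
      · exact .inl ⟨by simpa [h] using h1, h2⟩
      · exact .inr h
  have h1 := key (G ⁻¹' B)
  have h2 := (key Set.univ).mul_const (μ.real (G ⁻¹' B))
  simp only [Set.inter_univ] at h2
  have h3 := tendsto_nhds_unique (h1.congr' ?_) h2
  · rw [measureReal_def, measureReal_def, measureReal_def, ← ENNReal.toReal_mul] at h3
    exact (ENNReal.toReal_eq_toReal_iff' (measure_ne_top _ _)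
      (ENNReal.mul_ne_top (measure_ne_top _ _) (measure_ne_top _ _))).1 h3
  · filter_upwards [hZ] with N hN
    rw [measureReal_def, measureReal_def, measureReal_def, ← ENNReal.toReal_mul,
      hN.measure_inter_preimage_eq_mul _ _ hA hB]

/-- The surrogate `evol` reads only the initial ages and the increments up to s. Increments over
disjoint cells are jointly independent across all events, and the initial ages are independent of
all clocks. -/
lemma indepFun_evol_ticks [IsProbabilityMeasure μ]
    (hclock : ∀ e, IsPoissonProcess μ (clock e) (net.rate e))
    (hindep : iIndepFun (fun e ω t => clock e t ω) μ)
    (hX : IsAgeProcess μ clock X)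
    (hX0 : IndepFun (X 0) (fun ω e t => clock e t ω) μ)
    {s t : ℝ≥0} (hst : s ≤ t) {N : ℕ} (hN : N ≠ 0) :
    IndepFun (fun ω =>
        evol (fun k => ticks clock (partPt 0 s N k) (partPt 0 s N (k + 1)) ω) (X 0 ω) N)
      (ticks clock s t) μ := by
  classical
  -- The partition of [0, s] is continued by t, so that the increment with index N is the one from s
  -- to t.
  let τ : ℕ → ℝ≥0 := fun k => if k ≤ N then partPt 0 s N k else t
  have hτ : Monotone τ := by
    intro k l hkl
    simp only [τ]
    split_ifs with h1 h2 h2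
    · exact partPt_mono 0 s N hkl
    · refine le_trans ?_ hst
      simpa [partPt_self (zero_le (a := s)) hN] using partPt_mono 0 s N h1
    · omega
    · exact le_rfl
  let D : Event n × ℕ → Ω → ℕ := fun q ω => clock q.1 (τ (q.2 + 1)) ω - clock q.1 (τ q.2) ω
  have hDm : ∀ q, Measurable (D q) := fun q =>
    ((hclock q.1).measurable _).sub ((hclock q.1).measurable _)
  have hD : iIndepFun D μ := by
    refine iIndepFun_uncurry' (X := fun e k ω => clock e (τ (k + 1)) ω - clock e (τ k) ω)
      (fun e k => hDm (e, k)) ?_ fun e => (hclock e).indepIncrements.nat hτ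
    exact hindep.comp (fun _ c k => c (τ (k + 1)) - c (τ k)) fun _ => by fun_prop
  let past : Finset (Event n × ℕ) := Finset.univ ×ˢ Finset.range N
  let next : Finset (Event n × ℕ) := Finset.univ ×ˢ {N}
  have hdisj : Disjoint past next := by
    rw [Finset.disjoint_left]
    simp only [past, next, Finset.mem_product, Finset.mem_univ, true_and, Finset.mem_range,
      Finset.mem_singleton]
    omega
  have hPQ := hD.indepFun_finset past next hdisj hDm
  have hU : IndepFun (X 0) (fun ω => ((fun i : past => D i ω), (fun i : next => D i ω))) μ :=
    hX0.comp measurable_id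
      (ψ := fun c : Event n → ℝ≥0 → ℕ =>
        ((fun i : past => c i.1.1 (τ (i.1.2 + 1)) - c i.1.1 (τ i.1.2)), (fun i : next =>
          c i.1.1 (τ (i.1.2 + 1)) - c i.1.1 (τ i.1.2)))) (by fun_prop)
  have hI := indepFun_prodMk_left (hX.measurable 0) (by fun_prop) (by fun_prop) hU hPQ
  have hmem : ∀ (e : Event n) (k : ℕ), k < N → (e, k) ∈ past := by simp [past]
  have hmem' : ∀ e : Event n, (e, N) ∈ next := by simp [next]
  convert hI.comp
    -- The value 0 is never read: N steps of `evol` use only indices k < N.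
    (φ := fun p => evol (fun k e => if h : (e, k) ∈ past then p.2 ⟨(e, k), h⟩ else 0) p.1 N)
    (ψ := fun q e => q ⟨(e, N), hmem' e⟩)
    Measurable.of_discrete (by fun_prop) using 1
  · ext1 ω
    refine evol_congr _ fun k hk => ?_
    ext e
    simp only [dif_pos (hmem e k hk), D, τ, ticks, if_pos hk.le, if_pos (Nat.succ_le_of_lt hk)]
  · ext ω e
    simp [D, τ, ticks, partPt_self (zero_le (a := s)) hN]

/-- The ages at time `s` are independent of the ticks after time `s`. -/
lemma indepFun_age_ticks [IsProbabilityMeasure μ]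
    (hclock : ∀ e, IsPoissonProcess μ (clock e) (net.rate e))
    (hindep : iIndepFun (fun e ω t => clock e t ω) μ)
    (hX : IsAgeProcess μ clock X)
    (hX0 : IndepFun (X 0) (fun ω e t => clock e t ω) μ)
    {s t : ℝ≥0} (hst : s ≤ t) :
    IndepFun (X s) (ticks clock s t) μ := by
  -- Up to a null set, `X s` differs from its surrogate only if the partition is not good.
  refine indepFun_of_tendsto_measureReal_ne ((eventually_ne_atTop 0).mono fun N hN =>
    indepFun_evol_ticks hclock hindep hX hX0 hst hN)
    (tendsto_of_tendsto_of_tendsto_of_le_of_le' tendsto_const_nhds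
      (tendsto_measureReal_not_goodPart hclock hindep 0 s)
      (.of_forall fun _ => measureReal_nonneg) ?_)
  filter_upwards [eventually_ne_atTop 0] with N hN
  refine ENNReal.toReal_mono (measure_ne_top _ _) (measure_mono_ae ?_)
  filter_upwards [ae_eq_evol hclock hX] with ω hω hne hgood
  refine hne ?_
  rw [← hω 0 s N hgood N le_rfl, partPt_self (zero_le (a := s)) hN]

end
-- Mean ages and their first-order expansion
lemma abs_inf'_jump_sub_le (T : Finset (Fin n)) (hT : T.Nonempty) (e : Event n)
    (x : Fin n → ℕ) :
    |((T.inf' hT (jump e x) : ℕ) : ℝ) - (T.inf' hT x : ℕ)| ≤ 1 + (T.inf' hT x : ℕ) := by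
  have h1 : ((T.inf' hT (jump e x) : ℕ) : ℝ) ≤ (T.inf' hT x : ℕ) + 1 := by
    exact_mod_cast inf'_jump_le T hT e x
  have h2 : (0 : ℝ) ≤ (T.inf' hT (jump e x) : ℕ) := Nat.cast_nonneg _
  have h3 : (0 : ℝ) ≤ (T.inf' hT x : ℕ) := Nat.cast_nonneg _
  rw [abs_le]
  constructor <;> linarith

lemma Network.abs_drift_le (net : Network n) (T : Finset (Fin n)) (hT : T.Nonempty)
    (x : Fin n → ℕ) : |net.drift T hT x| ≤ net.totalRate * (1 + (T.inf' hT x : ℕ)) := by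
  rw [drift, totalRate, NNReal.coe_sum, Finset.sum_mul]
  refine (Finset.abs_sum_le_sum_abs _ _).trans (Finset.sum_le_sum fun e _ => ?_)
  rw [abs_mul, abs_of_nonneg (NNReal.coe_nonneg _)]
  gcongr
  exact abs_inf'_jump_sub_le T hT e x

section

variable {net : Network n} {Ω : Type*} [MeasurableSpace Ω] {μ : Measure Ω}
  {clock : Event n → ℝ≥0 → Ω → ℕ} {X : ℝ≥0 → Ω → Fin n → ℕ}

/-- The expected minimal age of `T` at time `t`. -/
noncomputable def meanAge (μ : Measure Ω) (X : ℝ≥0 → Ω → Fin n → ℕ) (T : Finset (Fin n))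
    (hT : T.Nonempty) (t : ℝ≥0) : ℝ :=
  ∫ ω, ((T.inf' hT (X t ω) : ℕ) : ℝ) ∂μ

lemma meanAge_nonneg (T : Finset (Fin n)) (hT : T.Nonempty) (t : ℝ≥0) :
    0 ≤ meanAge μ X T hT t :=
  integral_nonneg fun _ => Nat.cast_nonneg _

lemma integral_ticks (hclock : ∀ e, IsPoissonProcess μ (clock e) (net.rate e)) {s t : ℝ≥0}
    (hst : s ≤ t) (e : Event n) :
    ∫ ω, (ticks clock s t ω e : ℝ) ∂μ = net.rate e * (t - s) := by
  have := integral_descFactorial_of_hasLaw ((hclock e).law s t hst) 1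
  simpa [ticks, NNReal.coe_sub hst] using this

lemma integrable_ticks (hclock : ∀ e, IsPoissonProcess μ (clock e) (net.rate e)) {s t : ℝ≥0}
    (hst : s ≤ t) (e : Event n) : Integrable (fun ω => (ticks clock s t ω e : ℝ)) μ := by
  have := integrable_descFactorial_of_hasLaw ((hclock e).law s t hst) 1
  simpa [ticks] using this

lemma integrable_totalTicks (hclock : ∀ e, IsPoissonProcess μ (clock e) (net.rate e))
    {s t : ℝ≥0} (hst : s ≤ t) : Integrable (fun ω => (totalTicks clock s t ω : ℝ)) μ := by
  simp only [totalTicks, Nat.cast_sum]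
  exact integrable_finsetSum _ fun e _ => integrable_ticks hclock hst e

lemma integral_totalTicks (hclock : ∀ e, IsPoissonProcess μ (clock e) (net.rate e))
    {s t : ℝ≥0} (hst : s ≤ t) :
    ∫ ω, (totalTicks clock s t ω : ℝ) ∂μ = net.totalRate * (t - s) := by
  simp only [totalTicks, Nat.cast_sum, Network.totalRate, NNReal.coe_sum, Finset.sum_mul]
  rw [integral_finsetSum _ fun e _ => integrable_ticks hclock hst e]
  exact Finset.sum_congr rfl fun e _ => integral_ticks hclock hst e

lemma aestronglyMeasurable_comp_age (hX : IsAgeProcess μ clock X) (f : (Fin n → ℕ) → ℝ)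
    (t : ℝ≥0) : AEStronglyMeasurable (fun ω => f (X t ω)) μ :=
  ((Measurable.of_discrete (f := f)).comp (hX.measurable t)).aestronglyMeasurable

variable [IsProbabilityMeasure μ]

lemma integrable_minAge (hclock : ∀ e, IsPoissonProcess μ (clock e) (net.rate e))
    (hindep : iIndepFun (fun e ω t => clock e t ω) μ)
    (hX : IsAgeProcess μ clock X)
    (hint : ∀ i, Integrable (fun ω => (X 0 ω i : ℝ)) μ)
    (T : Finset (Fin n)) (hT : T.Nonempty) (t : ℝ≥0) :
    Integrable (fun ω => ((T.inf' hT (X t ω) : ℕ) : ℝ)) μ := by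
  obtain ⟨i, hi⟩ := id hT
  refine ((hint i).add (integrable_totalTicks hclock (zero_le (a := t)))).mono'
    (aestronglyMeasurable_comp_age hX (fun x => ((T.inf' hT x : ℕ) : ℝ)) t) ?_
  filter_upwards [ae_inf'_le hclock hindep hX T hT (zero_le (a := t))] with ω hω
  rw [Real.norm_of_nonneg (Nat.cast_nonneg _)]
  have := hω.trans (Nat.add_le_add_right (T.inf'_le _ hi) _)
  simp only [Pi.add_apply]
  exact_mod_cast this

lemma meanAge_le (hclock : ∀ e, IsPoissonProcess μ (clock e) (net.rate e))
    (hindep : iIndepFun (fun e ω t => clock e t ω) μ)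
    (hX : IsAgeProcess μ clock X)
    (hint : ∀ i, Integrable (fun ω => (X 0 ω i : ℝ)) μ)
    (T : Finset (Fin n)) (hT : T.Nonempty) (t : ℝ≥0) :
    meanAge μ X T hT t ≤ meanAge μ X T hT 0 + net.totalRate * t := by
  have h0 := integrable_minAge hclock hindep hX hint T hT 0
  have hK := integrable_totalTicks hclock (zero_le (a := t))
  have := integral_totalTicks hclock (zero_le (a := t))
  rw [NNReal.coe_zero, sub_zero] at this
  rw [meanAge, meanAge, ← this, ← integral_add h0 hK]
  refine integral_mono_ae (integrable_minAge hclock hindep hX hint T hT t) (h0.add hK) ?_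
  filter_upwards [ae_inf'_le hclock hindep hX T hT (zero_le (a := t))] with ω hω
  exact_mod_cast hω

lemma integrable_jump_sub (hclock : ∀ e, IsPoissonProcess μ (clock e) (net.rate e))
    (hindep : iIndepFun (fun e ω t => clock e t ω) μ)
    (hX : IsAgeProcess μ clock X)
    (hint : ∀ i, Integrable (fun ω => (X 0 ω i : ℝ)) μ)
    (T : Finset (Fin n)) (hT : T.Nonempty) (e : Event n) (t : ℝ≥0) :
    Integrable (fun ω => ((T.inf' hT (jump e (X t ω)) : ℕ) : ℝ) - (T.inf' hT (X t ω) : ℕ)) μ := by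
  refine ((integrable_const (1 : ℝ)).add (integrable_minAge hclock hindep hX hint T hT t)).mono'
    (aestronglyMeasurable_comp_age hX
      (fun x => ((T.inf' hT (jump e x) : ℕ) : ℝ) - (T.inf' hT x : ℕ)) t) ?_
  exact .of_forall fun ω => abs_inf'_jump_sub_le T hT e (X t ω)

lemma integrable_drift (hclock : ∀ e, IsPoissonProcess μ (clock e) (net.rate e))
    (hindep : iIndepFun (fun e ω t => clock e t ω) μ)
    (hX : IsAgeProcess μ clock X)
    (hint : ∀ i, Integrable (fun ω => (X 0 ω i : ℝ)) μ)
    (T : Finset (Fin n)) (hT : T.Nonempty) (t : ℝ≥0) :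
    Integrable (fun ω => net.drift T hT (X t ω)) μ :=
  integrable_finsetSum _ fun e _ =>
    (integrable_jump_sub hclock hindep hX hint T hT e t).const_mul _

lemma abs_integral_drift_le (hclock : ∀ e, IsPoissonProcess μ (clock e) (net.rate e))
    (hindep : iIndepFun (fun e ω t => clock e t ω) μ)
    (hX : IsAgeProcess μ clock X)
    (hint : ∀ i, Integrable (fun ω => (X 0 ω i : ℝ)) μ)
    (T : Finset (Fin n)) (hT : T.Nonempty) (t : ℝ≥0) :
    |∫ ω, net.drift T hT (X t ω) ∂μ| ≤ net.totalRate * (1 + meanAge μ X T hT t) := by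
  have hi := integrable_minAge hclock hindep hX hint T hT t
  refine (abs_integral_le_integral_abs).trans ((integral_mono
    (integrable_drift hclock hindep hX hint T hT t).abs
    (((integrable_const (1 : ℝ)).add hi).const_mul _)
    fun ω => net.abs_drift_le T hT (X t ω)).trans_eq ?_)
  rw [integral_const_mul]
  simp only [Pi.add_apply]
  rw [integral_add (integrable_const _) hi]
  simp [meanAge]

lemma integral_drift (hclock : ∀ e, IsPoissonProcess μ (clock e) (net.rate e))
    (hindep : iIndepFun (fun e ω t => clock e t ω) μ)
    (hX : IsAgeProcess μ clock X)
    (hint : ∀ i, Integrable (fun ω => (X 0 ω i : ℝ)) μ)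
    (T : Finset (Fin n)) (hT : T.Nonempty) (t : ℝ≥0) :
    ∫ ω, net.drift T hT (X t ω) ∂μ =
      (net.srcRate
        + ∑ i ∈ net.gossipNbrs T,
          (net.gossipInto i T : ℝ) * meanAge μ X (insert i T) (T.insert_nonempty i) t
        + ∑ i ∈ net.mobNbrs T,
          (net.mobInto i T : ℝ) * meanAge μ X (insert i T) (T.insert_nonempty i) t)
      - net.totalInto T * meanAge μ X T hT t := by
  have hi := fun i =>
    integrable_minAge hclock hindep hX hint (insert i T) (T.insert_nonempty i) t
  have hT' := integrable_minAge hclock hindep hX hint T hT t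
  have hs : ∀ (c : Fin n → ℝ) (A : Finset (Fin n)),
      Integrable (fun ω => ∑ i ∈ A, c i *
        ((((insert i T).inf' (T.insert_nonempty i) (X t ω) : ℕ) : ℝ)
          - (T.inf' hT (X t ω) : ℕ))) μ ∧
      ∫ ω, ∑ i ∈ A, c i *
        ((((insert i T).inf' (T.insert_nonempty i) (X t ω) : ℕ) : ℝ)
          - (T.inf' hT (X t ω) : ℕ)) ∂μ =
      ∑ i ∈ A, c i * meanAge μ X (insert i T) (T.insert_nonempty i) t
        - (∑ i ∈ A, c i) * meanAge μ X T hT t := by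
    intro c A
    have hint' : ∀ i ∈ A, Integrable (fun ω => c i *
        ((((insert i T).inf' (T.insert_nonempty i) (X t ω) : ℕ) : ℝ)
          - (T.inf' hT (X t ω) : ℕ))) μ := fun i _ => ((hi i).sub hT').const_mul _
    refine ⟨integrable_finsetSum _ hint', ?_⟩
    rw [integral_finsetSum _ hint', Finset.sum_mul, ← Finset.sum_sub_distrib]
    refine Finset.sum_congr rfl fun i _ => ?_
    rw [integral_const_mul, integral_sub (hi i) hT', meanAge, meanAge, mul_sub]
  obtain ⟨hg, hg'⟩ := hs (fun i => net.gossipInto i T) (net.gossipNbrs T)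
  obtain ⟨hm, hm'⟩ := hs (fun i => net.mobInto i T) (net.mobNbrs T)
  have hmean : ∫ ω, ((T.inf' hT (X t ω) : ℕ) : ℝ) ∂μ = meanAge μ X T hT t := rfl
  simp_rw [Network.drift_eq]
  have h1 := (integrable_const (net.srcRate : ℝ)).fun_add hg
  have h2 := h1.fun_add hm
  rw [integral_sub h2 (hT'.const_mul _), integral_add h1 hm, integral_add (integrable_const _) hg,
    integral_const_mul, hg', hm', hmean, Network.totalInto]
  simp only [integral_const, probReal_univ, smul_eq_mul, one_mul]
  push_cast
  ring

/-- With at most one tick the expansion is exact. With K ≥ 2 ticks both the true change and the sum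
are at most K(1 + f_T), and K ≤ K(K - 1). -/
lemma abs_sub_sum_ticks_le (T : Finset (Fin n)) (hT : T.Nonempty) {g : Event n → ℕ}
    {x y : Fin n → ℕ} (hstep : ∑ e, g e ≤ 1 → y = step g x)
    (hle : T.inf' hT y ≤ T.inf' hT x + ∑ e, g e) :
    |((T.inf' hT y : ℕ) : ℝ) - (T.inf' hT x : ℕ) -
        ∑ e, (g e : ℝ) * (((T.inf' hT (jump e x) : ℕ) : ℝ) - (T.inf' hT x : ℕ))| ≤
      2 * ((1 + (T.inf' hT x : ℕ)) * ((∑ e, g e).descFactorial 2 : ℕ)) := by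
  by_cases h : ∑ e, g e ≤ 1
  · have h0 : ((T.inf' hT y : ℕ) : ℝ) - (T.inf' hT x : ℕ) -
        ∑ e, (g e : ℝ) * (((T.inf' hT (jump e x) : ℕ) : ℝ) - (T.inf' hT x : ℕ)) = 0 := by
      rw [hstep h]
      rcases eq_zero_or_eq_single_of_sum_le_one h with rfl | ⟨e, rfl⟩
      · simp [step_zero]
      · rw [step_single, Finset.sum_eq_single e]
        · simp
        · intro e' _ he'
          rw [Pi.single_eq_of_ne he', Nat.cast_zero, zero_mul]
        · simp
    rw [h0, abs_zero]
    positivity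
  · set K := ∑ e, g e with hK
    have hK2 : K ≤ K.descFactorial 2 := by
      simp only [Nat.descFactorial_succ, Nat.descFactorial_zero, mul_one, tsub_zero]
      exact Nat.le_mul_of_pos_left _ (by omega)
    have hK2' : (K : ℝ) ≤ (K.descFactorial 2 : ℕ) := by exact_mod_cast hK2
    have hK1 : (1 : ℝ) ≤ K := by exact_mod_cast (by omega : 1 ≤ K)
    have hW : |∑ e, (g e : ℝ) * (((T.inf' hT (jump e x) : ℕ) : ℝ) - (T.inf' hT x : ℕ))| ≤
        K * (1 + (T.inf' hT x : ℕ)) := by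
      rw [hK, Nat.cast_sum, Finset.sum_mul]
      refine (Finset.abs_sum_le_sum_abs _ _).trans (Finset.sum_le_sum fun e _ => ?_)
      rw [abs_mul, Nat.abs_cast]
      gcongr
      exact abs_inf'_jump_sub_le T hT e x
    have hf : (0 : ℝ) ≤ (T.inf' hT x : ℕ) := Nat.cast_nonneg _
    have hf' : (0 : ℝ) ≤ (T.inf' hT y : ℕ) := Nat.cast_nonneg _
    have hle' : ((T.inf' hT y : ℕ) : ℝ) ≤ (T.inf' hT x : ℕ) + K := by exact_mod_cast hle
    have hd : |((T.inf' hT y : ℕ) : ℝ) - (T.inf' hT x : ℕ)| ≤ K * (1 + (T.inf' hT x : ℕ)) := by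
      rw [abs_le]
      constructor <;> nlinarith
    calc _ ≤ K * (1 + ((T.inf' hT x : ℕ) : ℝ)) + K * (1 + (T.inf' hT x : ℕ)) :=
          (abs_sub _ _).trans (add_le_add hd hW)
      _ = 2 * ((1 + (T.inf' hT x : ℕ)) * K) := by ring
      _ ≤ _ := by gcongr

/-- Independence of `X s` and the later ticks factors both expectations: the mean tick counts turn
the sum into (t - s) times the drift, and the second factorial moment gives the quadratic error. -/
lemma abs_meanAge_sub_le (hclock : ∀ e, IsPoissonProcess μ (clock e) (net.rate e))
    (hindep : iIndepFun (fun e ω t => clock e t ω) μ)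
    (hX : IsAgeProcess μ clock X)
    (hX0 : IndepFun (X 0) (fun ω e t => clock e t ω) μ)
    (hint : ∀ i, Integrable (fun ω => (X 0 ω i : ℝ)) μ)
    (T : Finset (Fin n)) (hT : T.Nonempty) {s t : ℝ≥0} (hst : s ≤ t) :
    |meanAge μ X T hT t - meanAge μ X T hT s
        - (t - s) * ∫ ω, net.drift T hT (X s ω) ∂μ| ≤
      2 * ((1 + meanAge μ X T hT s) * (net.totalRate * (t - s)) ^ 2) := by
  have hind := indepFun_age_ticks hclock hindep hX hX0 hst
  have hs := integrable_minAge hclock hindep hX hint T hT s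
  have ht := integrable_minAge hclock hindep hX hint T hT t
  have hj := fun e => integrable_jump_sub hclock hindep hX hint T hT e s
  have hlaw := hasLaw_totalTicks hclock hindep hst
  have hind1 : ∀ e, IndepFun (fun ω => (ticks clock s t ω e : ℝ))
      (fun ω => ((T.inf' hT (jump e (X s ω)) : ℕ) : ℝ) - (T.inf' hT (X s ω) : ℕ)) μ := fun e =>
    hind.symm.comp (φ := fun g : Event n → ℕ => (g e : ℝ))
      (ψ := fun x : Fin n → ℕ => ((T.inf' hT (jump e x) : ℕ) : ℝ) - (T.inf' hT x : ℕ))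
      Measurable.of_discrete Measurable.of_discrete
  have hind2 : IndepFun (fun ω => (1 : ℝ) + (T.inf' hT (X s ω) : ℕ))
      (fun ω => ((totalTicks clock s t ω).descFactorial 2 : ℝ)) μ :=
    hind.comp (φ := fun x : Fin n → ℕ => (1 : ℝ) + (T.inf' hT x : ℕ))
      (ψ := fun g : Event n → ℕ => ((∑ e, g e).descFactorial 2 : ℝ))
      Measurable.of_discrete Measurable.of_discrete
  have hs1 : Integrable (fun ω => (1 : ℝ) + (T.inf' hT (X s ω) : ℕ)) μ :=
    (integrable_const _).add hs
  have hK := integrable_descFactorial_of_hasLaw hlaw 2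
  have hW : ∀ e ∈ (Finset.univ : Finset (Event n)), Integrable (fun ω => (ticks clock s t ω e : ℝ) *
      (((T.inf' hT (jump e (X s ω)) : ℕ) : ℝ) - (T.inf' hT (X s ω) : ℕ))) μ := fun e _ =>
    (hind1 e).integrable_mul (integrable_ticks hclock hst e) (hj e)
  have hR := hind2.integrable_mul hs1 hK
  have hdrift : (t - s : ℝ) * ∫ ω, net.drift T hT (X s ω) ∂μ = ∫ ω, ∑ e,
      (ticks clock s t ω e : ℝ) *
        (((T.inf' hT (jump e (X s ω)) : ℕ) : ℝ) - (T.inf' hT (X s ω) : ℕ)) ∂μ := by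
    simp only [Network.drift]
    rw [integral_finsetSum _ hW, integral_finsetSum _ fun e _ => (hj e).const_mul _,
      Finset.mul_sum]
    refine Finset.sum_congr rfl fun e _ => ?_
    rw [(hind1 e).integral_fun_mul_eq_mul_integral
      (integrable_ticks hclock hst e).aestronglyMeasurable (hj e).aestronglyMeasurable,
      integral_ticks hclock hst, integral_const_mul]
    ring
  have hbound : (1 + meanAge μ X T hT s) * (net.totalRate * (t - s) : ℝ) ^ 2 =
      ∫ ω, ((1 : ℝ) + (T.inf' hT (X s ω) : ℕ)) * ((totalTicks clock s t ω).descFactorial 2 : ℝ)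
        ∂μ := by
    rw [hind2.integral_fun_mul_eq_mul_integral hs1.aestronglyMeasurable hK.aestronglyMeasurable,
      integral_descFactorial_of_hasLaw hlaw 2, integral_add (integrable_const _) hs]
    simp [meanAge, NNReal.coe_sub hst]
  have hts : Integrable (fun ω => ((T.inf' hT (X t ω) : ℕ) : ℝ) - (T.inf' hT (X s ω) : ℕ)) μ :=
    ht.sub hs
  rw [hdrift, hbound, ← integral_const_mul, meanAge, meanAge, ← integral_sub ht hs,
    ← integral_sub hts (integrable_finsetSum _ hW)]
  refine abs_integral_le_integral_abs.trans (integral_mono_ae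
    (hts.sub (integrable_finsetSum _ hW)).abs (hR.const_mul 2) ?_)
  filter_upwards [ae_eq_step hclock hX, ae_inf'_le hclock hindep hX T hT hst] with ω h1 h2
  exact abs_sub_sum_ticks_le T hT (h1 s t hst) h2

end
-- Right derivatives and relaxation on the half-line
lemma continuousOn_and_hasDerivWithinAt_of_abs_sub_le {m L C : ℝ → ℝ}
    (hC : MonotoneOn C (Set.Ici 0)) (hL : ∀ s, 0 ≤ s → |L s| ≤ C s)
    (h : ∀ s t, 0 ≤ s → s ≤ t → |m t - m s - (t - s) * L s| ≤ (t - s) ^ 2 * C s) :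
    ContinuousOn m (Set.Ici 0) ∧ ∀ s, 0 ≤ s → HasDerivWithinAt m (L s) (Set.Ici s) s := by
  constructor
  · have hlip : ∀ b, 0 ≤ b → ∀ s t, 0 ≤ s → s ≤ t → t ≤ b →
        |m t - m s| ≤ (t - s) * (C b * (1 + b)) := by
      intro b hb s t hs hst htb
      have h1 := h s t hs hst
      have hCs : C s ≤ C b := hC hs hb (hst.trans htb)
      have hC0 : 0 ≤ C s := (abs_nonneg _).trans (hL s hs)
      have h2 : |(t - s) * L s| ≤ (t - s) * C s := by
        rw [abs_mul, abs_of_nonneg (sub_nonneg.2 hst)]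
        exact mul_le_mul_of_nonneg_left (hL s hs) (sub_nonneg.2 hst)
      have h3 : |m t - m s| ≤ (t - s) * (C s * (1 + (t - s))) := by
        have := abs_add_le (m t - m s - (t - s) * L s) ((t - s) * L s)
        rw [sub_add_cancel] at this
        linarith
      refine h3.trans (mul_le_mul_of_nonneg_left ?_ (sub_nonneg.2 hst))
      exact mul_le_mul hCs (by linarith) (by linarith) (hC0.trans hCs)
    have hcont : ∀ b, 0 ≤ b → ContinuousOn m (Set.Icc 0 b) := by
      intro b hb
      have hK : 0 ≤ C b * (1 + b) :=
        mul_nonneg ((abs_nonneg _).trans (hL b hb)) (by linarith)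
      refine (LipschitzOnWith.of_dist_le_mul (K := (C b * (1 + b)).toNNReal)
        fun s hs t ht => ?_).continuousOn
      rw [Real.dist_eq, Real.dist_eq, Real.coe_toNNReal _ hK, mul_comm]
      rcases le_total s t with hst | hst
      · rw [abs_sub_comm, abs_sub_comm s t, abs_of_nonneg (sub_nonneg.2 hst)]
        exact hlip b hb s t hs.1 hst ht.2
      · rw [abs_of_nonneg (sub_nonneg.2 hst)]
        exact hlip b hb t s ht.1 hst hs.2
    intro s hs
    have hs0 : 0 ≤ s := hs
    refine ((hcont (s + 1) (by linarith)) s ⟨hs, by linarith⟩).mono_of_mem_nhdsWithin ?_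
    rw [← Set.Ici_inter_Iic]
    exact inter_mem_nhdsWithin _ (Iic_mem_nhds (by linarith))
  · intro s hs
    rw [hasDerivWithinAt_iff_isLittleO]
    have hO : (fun t => m t - m s - (t - s) • L s) =O[𝓝[Set.Ici s] s] fun t => (t - s) ^ 2 := by
      refine Asymptotics.IsBigO.of_bound (C s) ?_
      filter_upwards [self_mem_nhdsWithin] with t ht
      rw [Real.norm_eq_abs, Real.norm_eq_abs, abs_of_nonneg (sq_nonneg (t - s)), smul_eq_mul,
        mul_comm (C s)]
      exact h s t hs ht
    refine hO.trans_isLittleO ?_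
    have ht : Tendsto (fun t => t - s) (𝓝[Set.Ici s] s) (𝓝 0) := by
      have : Tendsto (fun t => t - s) (𝓝 s) (𝓝 (s - s)) := (continuous_sub_right s).tendsto s
      rw [sub_self] at this
      exact this.mono_left nhdsWithin_le_nhds
    exact (Asymptotics.isLittleO_pow_id one_lt_two).comp_tendsto ht

/-- A function relaxing at a positive rate towards a convergent target converges. -/
lemma tendsto_of_relaxation {m g : ℝ → ℝ} {D γ : ℝ} (hD : 0 < D)
    (hm : ContinuousOn m (Set.Ici 0))
    (hd : ∀ t, 0 ≤ t → HasDerivWithinAt m (g t - D * m t) (Set.Ici t) t)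
    (hg : Tendsto g atTop (𝓝 γ)) : Tendsto m atTop (𝓝 (γ / D)) := by
  rw [Metric.tendsto_atTop]
  intro ε hε
  obtain ⟨a, ha⟩ := Metric.tendsto_atTop.1 hg (D * (ε / 2)) (by positivity)
  wlog ha0 : 0 ≤ a generalizing a
  · exact this 0 (fun t ht => ha t (by linarith)) le_rfl
  set W := |m a - γ / D| with hW
  have hbound : ∀ t, a ≤ t → |m t - γ / D| ≤ W * Real.exp (-(D * (t - a))) + ε / 2 := by
    intro t hat
    have hexp : ∀ x, HasDerivAt (fun y => Real.exp (D * (y - a))) (Real.exp (D * (x - a)) * D) x :=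
      fun x => by
        simpa using (((hasDerivAt_id x).sub_const a).const_mul D).exp
    -- The integrating factor removes the term D * m and leaves the derivative exp(D(x - a)) (g x -
    -- γ), which past a is dominated by that of B since |g x - γ| < D ε / 2.
    have key := image_norm_le_of_norm_deriv_right_le_deriv_boundary (a := a) (b := t)
      (f := fun x => Real.exp (D * (x - a)) * (m x - γ / D))
      (f' := fun x => Real.exp (D * (x - a)) * (g x - γ))
      (B := fun x => W + ε / 2 * (Real.exp (D * (x - a))))
      (B' := fun x => ε / 2 * (Real.exp (D * (x - a)) * D)) ?_ ?_ ?_ ?_ ?_ ⟨hat, le_rfl⟩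
    · simp only [norm_mul, Real.norm_eq_abs, Real.abs_exp] at key
      have hpos := Real.exp_pos (D * (t - a))
      rw [Real.exp_neg, ← div_eq_mul_inv, ← sub_le_iff_le_add, le_div_iff₀ hpos]
      linarith
    · refine ContinuousOn.mul (by fun_prop) ((hm.mono ?_).sub continuousOn_const)
      exact fun x hx => ha0.trans hx.1
    · intro x hx
      have hγ : D * (γ / D) = γ := mul_div_cancel₀ γ hD.ne'
      refine ((hexp x).hasDerivWithinAt.mul
        ((hd x (ha0.trans hx.1)).sub_const (γ / D))).congr_deriv ?_
      linear_combination (-Real.exp (D * (x - a))) * hγ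
    · simp [hW]
      linarith
    · intro x
      exact ((hexp x).const_mul _).const_add _
    · intro x hx
      rw [norm_mul, Real.norm_eq_abs, Real.abs_exp]
      have := (ha x hx.1).le
      rw [Real.dist_eq] at this
      calc _ ≤ Real.exp (D * (x - a)) * (D * (ε / 2)) := by gcongr; exact this
        _ = _ := by ring
  have hlim : Tendsto (fun t => W * Real.exp (-(D * (t - a)))) atTop (𝓝 0) := by
    have h1 : Tendsto (fun t => D * (t - a)) atTop atTop :=
      (tendsto_atTop_add_const_right _ (-a) tendsto_id).const_mul_atTop hD
    simpa using (Real.tendsto_exp_neg_atTop_nhds_zero.comp h1).const_mul W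
  obtain ⟨b, hb⟩ := Metric.tendsto_atTop.1 hlim (ε / 2) (by positivity)
  refine ⟨max a b, fun t ht => ?_⟩
  have h1 := hbound t ((le_max_left _ _).trans ht)
  have h2 := hb t ((le_max_right _ _).trans ht)
  rw [Real.dist_eq, sub_zero] at h2
  rw [Real.dist_eq]
  linarith [le_abs_self (W * Real.exp (-(D * (t - a))))]

/-! ### Convergence of the mean ages -/

section

variable {net : Network n} {Ω : Type*} [MeasurableSpace Ω] {μ : Measure Ω}
  [IsProbabilityMeasure μ] {clock : Event n → ℝ≥0 → Ω → ℕ} {X : ℝ≥0 → Ω → Fin n → ℕ}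

lemma continuousOn_and_hasDerivWithinAt_meanAge (hclock : ∀ e, IsPoissonProcess μ (clock e) (net.rate e))
    (hindep : iIndepFun (fun e ω t => clock e t ω) μ)
    (hX : IsAgeProcess μ clock X)
    (hX0 : IndepFun (X 0) (fun ω e t => clock e t ω) μ)
    (hint : ∀ i, Integrable (fun ω => (X 0 ω i : ℝ)) μ)
    (T : Finset (Fin n)) (hT : T.Nonempty) :
    ContinuousOn (fun t : ℝ => meanAge μ X T hT t.toNNReal) (Set.Ici 0) ∧
      ∀ s : ℝ, 0 ≤ s → HasDerivWithinAt (fun t : ℝ => meanAge μ X T hT t.toNNReal)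
        (∫ ω, net.drift T hT (X s.toNNReal ω) ∂μ) (Set.Ici s) s := by
  set Λ := (net.totalRate : ℝ) with hΛ
  have hΛ0 : 0 ≤ Λ := NNReal.coe_nonneg _
  have hm := fun t => meanAge_le hclock hindep hX hint T hT t
  refine continuousOn_and_hasDerivWithinAt_of_abs_sub_le
    -- Λ comes from the drift bound, 2Λ² from the quadratic error, and the last factor from the
    -- linear growth of the mean age.
    (C := fun s => (Λ + 2 * Λ ^ 2) * (1 + (meanAge μ X T hT 0 + Λ * s))) ?_ ?_ ?_
  · intro s _ t _ hst
    dsimp only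
    gcongr
  · intro s hs
    have hs' := hm s.toNNReal
    rw [Real.coe_toNNReal s hs] at hs'
    have h0 := meanAge_nonneg (μ := μ) (X := X) T hT s.toNNReal
    calc _ ≤ Λ * (1 + meanAge μ X T hT s.toNNReal) :=
          abs_integral_drift_le hclock hindep hX hint T hT s.toNNReal
      _ ≤ (Λ + 2 * Λ ^ 2) * (1 + meanAge μ X T hT s.toNNReal) := by
          gcongr
          nlinarith
      _ ≤ _ := by gcongr
  · intro s t hs hst
    have hs' := hm s.toNNReal
    have h := abs_meanAge_sub_le hclock hindep hX hX0 hint T hT (Real.toNNReal_le_toNNReal hst)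
    rw [Real.coe_toNNReal s hs, Real.coe_toNNReal t (hs.trans hst)] at h
    rw [Real.coe_toNNReal s hs] at hs'
    have h0 := meanAge_nonneg (μ := μ) (X := X) T hT s.toNNReal
    refine h.trans ?_
    calc _ = (t - s) ^ 2 * ((2 * Λ ^ 2) * (1 + meanAge μ X T hT s.toNNReal)) := by
          rw [← hΛ]; ring
      _ ≤ (t - s) ^ 2 * ((Λ + 2 * Λ ^ 2) * (1 + meanAge μ X T hT s.toNNReal)) := by
          gcongr
          linarith
      _ ≤ _ := by gcongr

lemma tendsto_meanAge (hclock : ∀ e, IsPoissonProcess μ (clock e) (net.rate e))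
    (hindep : iIndepFun (fun e ω t => clock e t ω) μ)
    (hX : IsAgeProcess μ clock X)
    (hX0 : IndepFun (X 0) (fun ω e t => clock e t ω) μ)
    (hint : ∀ i, Integrable (fun ω => (X 0 ω i : ℝ)) μ)
    (T : Finset (Fin n)) (hT : T.Nonempty) (hD : 0 < net.totalInto T) {v : Fin n → ℝ}
    (hv : ∀ i ∉ T, Tendsto (meanAge μ X (insert i T) (T.insert_nonempty i)) atTop (𝓝 (v i))) :
    Tendsto (meanAge μ X T hT) atTop (𝓝
      ((net.srcRate + ∑ i ∈ net.gossipNbrs T, net.gossipInto i T * v i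
        + ∑ i ∈ net.mobNbrs T, net.mobInto i T * v i) / net.totalInto T)) := by
  obtain ⟨hcont, hderiv⟩ := continuousOn_and_hasDerivWithinAt_meanAge hclock hindep hX hX0 hint T hT
  have hv' : ∀ i ∉ T, Tendsto (fun t : ℝ =>
      meanAge μ X (insert i T) (T.insert_nonempty i) t.toNNReal) atTop (𝓝 (v i)) :=
    fun i hi => (hv i hi).comp tendsto_real_toNNReal_atTop
  have hlim := tendsto_of_relaxation (D := net.totalInto T) (by exact_mod_cast hD) hcont
    (fun t ht => by
      have := hderiv t ht
      rwa [integral_drift hclock hindep hX hint T hT] at this)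
    ((tendsto_const_nhds.add (tendsto_finsetSum _ fun i hi => (hv' i ?_).const_mul _)).add
      (tendsto_finsetSum _ fun i hi => (hv' i ?_).const_mul _))
  · refine (hlim.comp (NNReal.tendsto_coe_atTop.2 tendsto_id)).congr fun t => ?_
    simp
  · simp only [Network.gossipNbrs, Finset.mem_filter] at hi
    exact hi.2.1
  · simp only [Network.mobNbrs, Finset.mem_filter] at hi
    exact hi.2.1

/-- The target for T involves only sets with one more node, so the induction is on the size of the
complement; for T the set of all nodes, no such set occurs. -/
lemma exists_tendsto_meanAge (hclock : ∀ e, IsPoissonProcess μ (clock e) (net.rate e))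
    (hindep : iIndepFun (fun e ω t => clock e t ω) μ)
    (hX : IsAgeProcess μ clock X)
    (hX0 : IndepFun (X 0) (fun ω e t => clock e t ω) μ)
    (hint : ∀ i, Integrable (fun ω => (X 0 ω i : ℝ)) μ)
    (T : Finset (Fin n)) (hT : T.Nonempty) (hD : ∀ T', T ⊆ T' → 0 < net.totalInto T') :
    ∃ v, Tendsto (meanAge μ X T hT) atTop (𝓝 v) := by
  induction hk : Tᶜ.card using Nat.strong_induction_on generalizing T with
  | _ k ih =>
  have hex : ∀ i, ∃ v, i ∉ T →
      Tendsto (meanAge μ X (insert i T) (T.insert_nonempty i)) atTop (𝓝 v) := by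
    intro i
    by_cases hi : i ∈ T
    · exact ⟨0, fun h => absurd hi h⟩
    · obtain ⟨v, hv⟩ := ih (insert i T)ᶜ.card (hk ▸ Finset.card_lt_card
        (Finset.compl_ssubset_compl.2 (Finset.ssubset_insert hi))) (insert i T)
        (T.insert_nonempty i) (fun T' h => hD T' ((Finset.subset_insert i T).trans h)) rfl
      exact ⟨v, fun _ => hv⟩
  choose v hv using hex
  exact ⟨_, tendsto_meanAge hclock hindep hX hX0 hint T hT (hD T subset_rfl) hv⟩

end
end Gossip

theorem proposition1 {n : ℕ} (net : Gossip.Network n)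
    {Ω : Type*} [MeasurableSpace Ω] (μ : Measure Ω) [IsProbabilityMeasure μ]
    (clock : Gossip.Event n → ℝ≥0 → Ω → ℕ)
    (hclock : ∀ e, Gossip.IsPoissonProcess μ (clock e) (net.rate e))
    (hindep : iIndepFun (fun e ω t => clock e t ω) μ)
    (X : ℝ≥0 → Ω → Fin n → ℕ)
    (hX : Gossip.IsAgeProcess μ clock X)
    (hX0 : IndepFun (X 0) (fun ω e t => clock e t ω) μ)
    (hint : ∀ i, Integrable (fun ω => (X 0 ω i : ℝ)) μ) :
    ∃ v : Finset (Fin n) → ℝ, ∀ (S : Finset (Fin n)) (hS : S.Nonempty),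
      (∀ T : Finset (Fin n), S ⊆ T → 0 < net.totalInto T) →
      Gossip.HasSteadyAge μ X S hS (v S) ∧
      v S =
        (net.srcRate
          + ∑ i ∈ net.gossipNbrs S, net.gossipInto i S * v (insert i S)
          + ∑ i ∈ net.mobNbrs S, net.mobInto i S * v (insert i S)) /
        (net.pushInto S
          + ∑ i ∈ net.gossipNbrs S, net.gossipInto i S
          + net.srcMobInto S
          + ∑ i ∈ net.mobNbrs S, net.mobInto i S) := by
  classical
  -- A single v must serve all S, so it is defined by `limUnder`, with 0 at the empty set;
  -- uniqueness of limits then yields the recursion.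
  have hlim : ∀ (S : Finset (Fin n)) (hS : S.Nonempty),
      (∀ T : Finset (Fin n), S ⊆ T → 0 < net.totalInto T) →
      Tendsto (Gossip.meanAge μ X S hS) atTop
        (𝓝 (if hS : S.Nonempty then limUnder atTop (Gossip.meanAge μ X S hS) else 0)) := by
    intro S hS hD
    rw [dif_pos hS]
    exact tendsto_nhds_limUnder
      (Gossip.exists_tendsto_meanAge hclock hindep hX hX0 hint S hS hD)
  refine ⟨fun S => if hS : S.Nonempty then limUnder atTop (Gossip.meanAge μ X S hS) else 0,
    fun S hS hD => ⟨⟨Gossip.integrable_minAge hclock hindep hX hint S hS, hlim S hS hD⟩, ?_⟩⟩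
  have h := tendsto_nhds_unique (hlim S hS hD) (Gossip.tendsto_meanAge hclock hindep hX hX0 hint
    S hS (hD S subset_rfl) fun i _ => hlim (insert i S) (S.insert_nonempty i) fun T hT =>
      hD T ((Finset.subset_insert i S).trans hT))
  dsimp only
  rw [h, Gossip.Network.totalInto]
  push_cast
  rfl
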